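/- Let $\mathcal S$ be a standard Borel space, $\mathcal A$ a measurable space, and let $R(s,a)\in\mathbb R$ (bounded, measurable), $P(\cdot\mid s,a)$ (a Markov kernel) and $\gamma\in[0,1)$ define a Markov decision process. A policy $\pi$ is a Markov kernel from $\mathcal S$ to $\mathcal A$; write $R^\pi_s=\mathbb E_{a\sim\pi(s)}R(s,a)$, $P^\pi_s=\mathbb E_{a\sim\pi(s)}P(\cdot\mid s,a)$, and $V^\pi(s)=\sum_{t\ge 0}\gamma^t\,\mathbb E^\pi[R(s_t,a_t)\mid s_0=s]$. A policy $\pi^*$ is optimal if $V^{\pi}\le V^{\pi^*}$ pointwise for every policy $\pi$. Assume that for every bounded measurable $V:\mathcal S\to\mathbb R$ the maxima over $a$ of $R(s,a)+\gamma\int V\,dP(\cdot\mid s,a)$ are attained at points $G(V)(s)$, measurably in $s$, where $G$ is a fixed rule that resolves ties (such a rule always exists if $\mathcal A$ is finite and non-empty). Policy improvement is the map $I(\pi)=G(V^\pi)$, and a continuously improving policy is a sequence $\pi_{k+1}=I(\pi_k)$ started at an arbitrary policy $\pi_0$. Let $\mathfrak{met}$ be the set of bounded pseudometrics on $\mathcal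 S$, ordered pointwise, let $c\in[0,1)$, and put $$\mathcal F(d,\pi)(s_i,s_j)=(1-c)\,|R^\pi_{s_i}-R^\pi_{s_j}|+c\,W(d)(P^\pi_{s_i},P^\pi_{s_j}),\qquad W(d)(\mu,\nu)=\inf_{\kappa}\int d\,d\kappa,$$ where $\kappa$ runs over the couplings of $\mu$ and $\nu$ (the integral is an upper integral if $d$ is not measurable). Call $d\in\mathfrak{met}$ a $\pi$-bisimulation metric if $d=\mathcal F(d,\pi)$. Then: 1. $\mathcal F(d,\pi)\in\mathfrak{met}$ for all $d\in\mathfrak{met}$ and every policy $\pi$, and for each policy $\pi$ the map $\mathcal F(\cdot,\pi)$ has a least fixed point in $\mathfrak{met}$. 2. There is exactly one policy $\pi^*$ with $I(\pi^*)=\pi^*$, and it is optimal. There is a least $\tilde d\in\mathfrak{met}$ among all $d\in\mathfrak{met}$ for which $\mathcal F(d,\pi)=d$ for some $\pi$ with $I(\pi)=\pi$; and $\tilde d$ is a $\pi^*$-bisimulation metric. 3. For every $\pi_0$, the sequence $\pi_{k+1}=I(\pi_k)$ satisfies $V^{\pi_k}\le V^{\pi_{k+1}}$ for all $k$, and $V^{\pi_k}\to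 V^{\pi^*}$ uniformly. If $\mathcal S$ and $\mathcal A$ are finite, then $\pi_k=\pi^*$ for all large $k$. Whenever $\pi_k=\pi^*$ for all large $k$, the iterates $d_{n+1}=\mathcal F(d_n,\pi_n)$ from any $d_0\in\mathfrak{met}$ converge uniformly to $\tilde d$. -/

import Mathlib

open MeasureTheory ProbabilityTheory Filter
open scoped ENNReal

noncomputable section

namespace BisimControl

variable {S A : Type*} [MeasurableSpace S] [MeasurableSpace A]

/-- A discounted Markov decision process with state space `S` and action space `A`:
bounded measurable (expected immediate) rewards `R(s,a)`, transition probabilities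
`P(· | s,a)`, and a discount factor in `[0,1)`. -/
structure MDP (S A : Type*) [MeasurableSpace S] [MeasurableSpace A] where
  reward : S → A → ℝ
  measurable_reward : Measurable (fun p : S × A => reward p.1 p.2)
  bounded_reward : ∃ C : ℝ, ∀ s a, |reward s a| ≤ C
  trans : Kernel (S × A) S
  markov_trans : IsMarkovKernel trans
  disc : ℝ
  disc_nonneg : 0 ≤ disc
  disc_lt_one : disc < 1

/-- A (stationary, possibly randomized) policy: a Markov kernel from states to actions. -/
abbrev Policy (S A : Type*) [MeasurableSpace S] [MeasurableSpace A] : Type _ :=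
  {π : Kernel S A // IsMarkovKernel π}

/-- The set `𝔪𝔢𝔱` of bounded pseudometrics on `S` (nonnegativity follows from the axioms). -/
def met (S : Type*) : Set (S → S → ℝ) :=
  {d | (∀ x, d x x = 0) ∧ (∀ x y, d x y = d y x) ∧ (∀ x y z, d x z ≤ d x y + d y z) ∧
    ∃ C : ℝ, ∀ x y, d x y ≤ C}

/-- The couplings of `μ` and `ν`. -/
def couplings (μ ν : Measure S) : Set (Measure (S × S)) :=
  {κ | κ.map Prod.fst = μ ∧ κ.map Prod.snd = ν}

/-- The integral of a nonnegative cost `d` against `κ`, taken as an upper integral so that it makes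
sense for every pseudometric, measurable or not. For measurable `d` it is the usual integral, see
`transportCost_eq_lintegral`. -/
def transportCost (d : S → S → ℝ) (κ : Measure (S × S)) : ℝ≥0∞ :=
  ⨅ (g : S × S → ℝ≥0∞) (_ : Measurable g) (_ : ∀ p, ENNReal.ofReal (d p.1 p.2) ≤ g p),
    ∫⁻ p, g p ∂κ

theorem transportCost_eq_lintegral (d : S → S → ℝ) (κ : Measure (S × S))
    (hd : Measurable fun p : S × S => d p.1 p.2) :
    transportCost d κ = ∫⁻ p, ENNReal.ofReal (d p.1 p.2) ∂κ := by
  refine le_antisymm (iInf_le_of_le _ (iInf_le_of_le hd.ennreal_ofReal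
    (iInf_le_of_le (fun _ => le_rfl) le_rfl))) ?_
  exact le_iInf fun g => le_iInf fun _ => le_iInf fun h => lintegral_mono h

/-- The 1-Wasserstein distance `W(d)(μ, ν) = inf over couplings κ of ∫ d dκ`. -/
def wasserstein (d : S → S → ℝ) (μ ν : Measure S) : ℝ :=
  (⨅ κ ∈ couplings μ ν, transportCost d κ).toReal

namespace MDP

variable (M : MDP S A)

/-- `R^π_s = E_{a ∼ π(s)} R(s,a)`. -/
def policyReward (π : Policy S A) (s : S) : ℝ := ∫ a, M.reward s a ∂(π.1 s)

/-- `P^π_s`, the law of the next state from `s` when the action is drawn from `π(s)`. -/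
def policyTrans (π : Policy S A) : Kernel S S := (π.1 ⊗ₖ M.trans).snd

/-- The expected reward at time `t` when starting in `s` and following `π`. -/
def expReward (π : Policy S A) : ℕ → S → ℝ
  | 0, s => M.policyReward π s
  | t + 1, s => ∫ s', expReward π t s' ∂(M.policyTrans π s)

/-- The value function `V^π(s) = ∑_t γ^t E[r_t | s_0 = s]`. -/
def value (π : Policy S A) (s : S) : ℝ := ∑' t : ℕ, M.disc ^ t * M.expReward π t s

/-- `π` is optimal: its value dominates the value of every policy at every state. -/
def IsOptimal (π : Policy S A) : Prop := ∀ (π' : Policy S A) (s : S), M.value π' s ≤ M.value π s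

/-- One-step lookahead `R(s,a) + γ ∑_{s'} P(s'|s,a) V(s')`. -/
def lookahead (V : S → ℝ) (s : S) (a : A) : ℝ :=
  M.reward s a + M.disc * ∫ s', V s' ∂(M.trans (s, a))

/-- A rule `V ↦ (s ↦ argmax_a [R(s,a) + γ ∑_{s'} P(s'|s,a) V(s')])` that resolves ties,
defined by its maximizing property at bounded measurable `V`. -/
structure ArgmaxRule where
  toFun : (S → ℝ) → S → A
  measurable_toFun : ∀ V, Measurable (toFun V)
  is_argmax : ∀ V : S → ℝ, Measurable V → (∃ C : ℝ, ∀ s, |V s| ≤ C) →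
    ∀ s a, M.lookahead V s a ≤ M.lookahead V s (toFun V s)

/-- With finitely many actions, an argmax rule always exists. -/
theorem ArgmaxRule.nonempty_of_finite [Finite A] [Nonempty A] : Nonempty M.ArgmaxRule := by
  classical
  have := M.markov_trans
  obtain ⟨n, ⟨e⟩⟩ := Finite.exists_equiv_fin A
  have hm : ∀ V : S → ℝ, Measurable V → ∀ a, Measurable (fun s => M.lookahead V s a) := by
    intro V hV a
    have h2 : Measurable (fun s : S => (s, a)) := measurable_id.prodMk measurable_const
    have h1 : Measurable (fun s => ∫ s', V s' ∂(M.trans (s, a))) :=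
      ((hV.stronglyMeasurable.integral_kernel (κ := M.trans)).measurable).comp h2
    exact (M.measurable_reward.comp h2).add (h1.const_mul _)
  have hex : ∀ (V : S → ℝ) s, ∃ i : Fin n, ∀ b, M.lookahead V s b ≤ M.lookahead V s (e.symm i) := by
    intro V s
    obtain ⟨a, ha⟩ := Finite.exists_max (M.lookahead V s)
    exact ⟨e a, by simpa using ha⟩
  refine ⟨⟨fun V s => if Measurable V then e.symm (Fin.find _ (hex V s))
    else Classical.arbitrary A, ?_, ?_⟩⟩
  · intro V
    by_cases hV : Measurable V
    swap
    · simp [hV]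
    simp only [hV, if_true]
    have hF : Measurable[_, ⊤] (fun s => Fin.find _ (hex V s)) := by
      refine @measurable_to_countable' _ _ ⊤ _ _ _ fun i => ?_
      have : ((fun s => Fin.find _ (hex V s)) ⁻¹' {i}) =
        {s | (∀ b, M.lookahead V s b ≤ M.lookahead V s (e.symm i)) ∧
          ∀ j < i, ¬ (∀ b, M.lookahead V s b ≤ M.lookahead V s (e.symm j))} := by
        ext s; simp [Fin.find_eq_iff]
      rw [this]
      have hs : ∀ j, MeasurableSet {s | ∀ b, M.lookahead V s b ≤ M.lookahead V s (e.symm j)} := by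
        intro j
        rw [Set.ofPred_forall]
        exact MeasurableSet.iInter fun b => measurableSet_le (hm V hV b) (hm V hV _)
      refine (hs i).inter ?_
      exact MeasurableSet.congr
        (MeasurableSet.iInter fun j => MeasurableSet.iInter fun (_ : j < i) => (hs j).compl) (by ext; simp; rfl)
    exact (@measurable_from_top _ _ _ e.symm).comp hF
  · intro V hV _ s a
    simp only [hV, if_true]
    exact Fin.find_spec (hex V s) a

variable {M} in
/-- One policy improvement step: `π ↦ argmax_a [R(s,a) + γ ∑_{s'} P(s'|s,a) V^π(s')]`. -/
def ArgmaxRule.improve (G : M.ArgmaxRule) (π : Policy S A) : Policy S A :=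
  ⟨Kernel.deterministic (G.toFun (M.value π)) (G.measurable_toFun _), inferInstance⟩

variable {M} in
/-- The policies `π_0, π_1, π_2, …` produced by policy iteration. -/
def ArgmaxRule.policyIter (G : M.ArgmaxRule) (π₀ : Policy S A) (k : ℕ) : Policy S A :=
  G.improve^[k] π₀

/-- The operator
`F(d,π)(s_i,s_j) = (1-c) |R^π_{s_i} - R^π_{s_j}| + c W(d)(P^π_{s_i}, P^π_{s_j})`. -/
def bisimOp (c : ℝ) (d : S → S → ℝ) (π : Policy S A) : S → S → ℝ := fun si sj =>
  (1 - c) * |M.policyReward π si - M.policyReward π sj| +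
    c * wasserstein d (M.policyTrans π si) (M.policyTrans π sj)

/-- `d` is a `π`-bisimulation metric: a bounded pseudometric whose value at each pair of states is
the weighted sum of the reward difference and of the Wasserstein distance, with respect to `d`
itself, of the transition laws under `π`. -/
def IsBisimMetric (c : ℝ) (π : Policy S A) (d : S → S → ℝ) : Prop :=
  d ∈ met S ∧ ∀ si sj, d si sj = (1 - c) * |M.policyReward π si - M.policyReward π sj| +
    c * wasserstein d (M.policyTrans π si) (M.policyTrans π sj)

/-- The iterates `d_{n+1} = F(d_n, π_n)` along a changing policy. -/
def metricIter (c : ℝ) (π : ℕ → Policy S A) (d₀ : S → S → ℝ) : ℕ → S → S → ℝ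
  | 0 => d₀
  | n + 1 => M.bisimOp c (metricIter c π d₀ n) (π n)

end MDP

end BisimControl

end

/-! Two contractions carry everything. The Bellman optimality operator contracts uniform distances
between bounded measurable functions by the factor `γ`. For fixed `π`, the operator `F(·,π)`
contracts uniform distances between bounded pseudometrics by the factor `c`, because the reward term
does not involve `d` and `W(d)` is 1-Lipschitz in `d`. Both classes are closed under uniform limits,
so each operator has exactly one fixed point; "least fixed point" then comes for free.

If `I(π) = π`, then `V^π` solves the Bellman optimality equation, so it is the unique solution `V`
and `π = G(V)`. Conversely `G(V)` has value `V`, which dominates every policy value. Hence one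
policy is fixed by `I`, and the least metric over such policies is its bisimulation metric
(`improve_eq_self_iff`, `bisimOp_fixed_unique`).

Policy iteration does at least as well as one Bellman step (`bellman_value_le_value_improve`), so
its error shrinks like `γ^k`. With finite spaces only finitely many values can occur after the first
step, so the limit is attained.

That `F(·,π)` preserves pseudometrics rests on the triangle inequality for `W(d)`, proved by gluing
couplings. Since `d` need not be measurable, the argument runs through measurable majorants. -/

namespace BisimControl

/-! ### Contractions in the uniform distance -/

section Contraction

variable {X : Type*}

/-- A function whose uniform upper bounds can be improved by a factor `c < 1` is nonpositive. -/
theorem nonpos_of_improving_bound {f : X → ℝ} {c : ℝ} (hc0 : 0 ≤ c) (hc1 : c < 1)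
    (hb : ∃ C, ∀ x, f x ≤ C) (h : ∀ m, 0 ≤ m → (∀ x, f x ≤ m) → ∀ x, f x ≤ c * m) (x : X) :
    f x ≤ 0 := by
  obtain ⟨C, hC⟩ := hb
  have key : ∀ n : ℕ, ∀ x, f x ≤ c ^ n * |C| := by
    intro n
    induction n with
    | zero => intro x; simpa using (hC x).trans (le_abs_self C)
    | succ n ih =>
      intro x
      have := h (c ^ n * |C|) (by positivity) ih x
      rwa [pow_succ', mul_assoc]
  have hlim : Tendsto (fun n : ℕ => c ^ n * |C|) atTop (nhds 0) := by
    simpa using (tendsto_pow_atTop_nhds_zero_of_lt_one hc0 hc1).mul_const |C|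
  exact ge_of_tendsto' hlim fun n => key n x

theorem tendstoUniformly_of_le_geometric {u : ℕ → X → ℝ} {f : X → ℝ} {c B : ℝ} (hc0 : 0 ≤ c)
    (hc1 : c < 1) (h : ∀ n x, |u n x - f x| ≤ c ^ n * B) : TendstoUniformly u f atTop := by
  have hlim : Tendsto (fun n : ℕ => c ^ n * B) atTop (nhds 0) := by
    simpa using (tendsto_pow_atTop_nhds_zero_of_lt_one hc0 hc1).mul_const B
  rw [Metric.tendstoUniformly_iff]
  intro ε hε
  filter_upwards [hlim.eventually_lt_const hε] with n hn x
  rw [dist_comm, Real.dist_eq]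
  exact (h n x).trans_lt hn

/-- `T` maps `K` to itself and contracts uniform distances by the factor `c`. -/
structure SupContraction (K : Set (X → ℝ)) (T : (X → ℝ) → X → ℝ) (c : ℝ) : Prop where
  nonneg : 0 ≤ c
  lt_one : c < 1
  bounded : ∀ f ∈ K, ∃ C, ∀ x, |f x| ≤ C
  mapsTo : ∀ f ∈ K, T f ∈ K
  contract : ∀ f ∈ K, ∀ g ∈ K, ∀ ε, 0 ≤ ε → (∀ x, |f x - g x| ≤ ε) →
    ∀ x, |T f x - T g x| ≤ c * ε

namespace SupContraction

variable {K : Set (X → ℝ)} {T : (X → ℝ) → X → ℝ} {c : ℝ}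

theorem exists_abs_sub_le (h : SupContraction K T c) {f g : X → ℝ} (hf : f ∈ K) (hg : g ∈ K) :
    ∃ B, 0 ≤ B ∧ ∀ x, |f x - g x| ≤ B := by
  obtain ⟨C, hC⟩ := h.bounded f hf
  obtain ⟨D, hD⟩ := h.bounded g hg
  refine ⟨|C| + |D|, by positivity, fun x => ?_⟩
  calc |f x - g x| ≤ |f x| + |g x| := abs_sub _ _
    _ ≤ |C| + |D| := add_le_add ((hC x).trans (le_abs_self _)) ((hD x).trans (le_abs_self _))

theorem eq_of_fixed (h : SupContraction K T c) {f g : X → ℝ} (hf : f ∈ K) (hg : g ∈ K)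
    (hTf : T f = f) (hTg : T g = g) : f = g := by
  obtain ⟨B, -, hB⟩ := h.exists_abs_sub_le hf hg
  funext x
  have := nonpos_of_improving_bound (f := fun x => |f x - g x|) h.nonneg h.lt_one ⟨B, hB⟩
    (fun m hm hb x => by simpa [hTf, hTg] using h.contract f hf g hg m hm hb x) x
  exact sub_eq_zero.1 (abs_nonpos_iff.1 this)

/-- The recursion is needed only eventually: the metric iterates follow a changing policy until
policy iteration has stabilized. The error at that moment is bounded and decays geometrically from
there on. -/
theorem tendstoUniformly (h : SupContraction K T c) {f : X → ℝ} (hf : f ∈ K) (hTf : T f = f)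
    {u : ℕ → X → ℝ} (hu : ∀ n, u n ∈ K) (hstep : ∀ᶠ n in atTop, u (n + 1) = T (u n)) :
    TendstoUniformly u f atTop := by
  obtain ⟨N, hN⟩ := eventually_atTop.1 hstep
  obtain ⟨B, hB0, hB⟩ := h.exists_abs_sub_le (hu N) hf
  have key : ∀ n x, |u (n + N) x - f x| ≤ c ^ n * B := by
    intro n
    induction n with
    | zero => simpa using hB
    | succ n ih =>
      intro x
      have := h.contract _ (hu (n + N)) f hf (c ^ n * B)
        (mul_nonneg (pow_nonneg h.nonneg n) hB0) ih x
      rw [hTf, ← hN (n + N) (by omega)] at this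
      rw [pow_succ', mul_assoc, show n + 1 + N = n + N + 1 by omega]
      exact this
  have := tendstoUniformly_of_le_geometric h.nonneg h.lt_one key
  rw [Metric.tendstoUniformly_iff] at this ⊢
  intro ε hε
  obtain ⟨n₀, hn₀⟩ := eventually_atTop.1 (this ε hε)
  filter_upwards [eventually_ge_atTop (n₀ + N)] with n hn x
  have := hn₀ (n - N) (by omega) x
  rwa [Nat.sub_add_cancel (by omega)] at this

/-- Banach's iteration. Completeness of `ℝ` gives pointwise limits, the geometric rate makes the
convergence uniform, and closure of `K` under uniform limits replaces completeness of `K`. -/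
theorem exists_fixed (h : SupContraction K T c) (hne : K.Nonempty)
    (hlim : ∀ u : ℕ → X → ℝ, (∀ n, u n ∈ K) → ∀ f, TendstoUniformly u f atTop → f ∈ K) :
    ∃ f ∈ K, T f = f := by
  obtain ⟨f₀, hf₀⟩ := hne
  set u : ℕ → X → ℝ := fun n => T^[n] f₀
  have hsucc : ∀ n, u (n + 1) = T (u n) := fun n => Function.iterate_succ_apply' T n f₀
  have huK : ∀ n, u n ∈ K := by
    intro n
    induction n with
    | zero => exact hf₀
    | succ n ih => rw [hsucc]; exact h.mapsTo _ ih
  obtain ⟨B, hB0, hB⟩ := h.exists_abs_sub_le (huK 0) (huK 1)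
  have hd : ∀ n x, |u n x - u (n + 1) x| ≤ B * c ^ n := by
    intro n
    induction n with
    | zero => simpa using hB
    | succ n ih =>
      intro x
      have := h.contract _ (huK n) _ (huK (n + 1)) (B * c ^ n)
        (mul_nonneg hB0 (pow_nonneg h.nonneg n)) ih x
      rw [hsucc (n + 1), hsucc n, ← hsucc n, pow_succ']
      rw [hsucc n] at this ⊢
      linarith
  have hex : ∀ x, ∃ a, Tendsto (fun n => u n x) atTop (nhds a) := fun x =>
    cauchySeq_tendsto_of_complete (cauchySeq_of_le_geometric c B h.lt_one fun n => hd n x)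
  choose f hf using hex
  have hdist : ∀ n x, |u n x - f x| ≤ c ^ n * (B / (1 - c)) := fun n x => by
    have := dist_le_of_le_geometric_of_tendsto c B h.lt_one (fun n => hd n x) (hf x) n
    rw [Real.dist_eq] at this
    exact this.trans_eq (by ring)
  have hunif := tendstoUniformly_of_le_geometric h.nonneg h.lt_one hdist
  have hfK := hlim u huK f hunif
  refine ⟨f, hfK, ?_⟩
  have h1c : 0 < 1 - c := sub_pos.2 h.lt_one
  have hT : TendstoUniformly (fun n => u (n + 1)) (T f) atTop := by
    refine tendstoUniformly_of_le_geometric (c := c) (B := c * (B / (1 - c))) h.nonneg h.lt_one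
      fun n x => ?_
    have := h.contract _ (huK n) f hfK (c ^ n * (B / (1 - c)))
      (mul_nonneg (pow_nonneg h.nonneg n) (by positivity)) (hdist n) x
    rw [hsucc]
    linarith
  funext x
  exact tendsto_nhds_unique (hT.tendsto_at x) ((tendsto_add_atTop_iff_nat 1).2 (hf x))

end SupContraction

end Contraction

/-! ### The Wasserstein pseudometric of a possibly non-measurable cost -/

section Wasserstein

theorem met_nonneg {S : Type*} {d : S → S → ℝ} (hd : d ∈ met S) (x y : S) : 0 ≤ d x y := by
  have h1 := hd.2.2.1 x y x
  rw [hd.1 x, ← hd.2.1 x y] at h1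
  linarith

variable {S : Type*} [MeasurableSpace S]

theorem isProbabilityMeasure_of_mem_couplings {μ ν : Measure S} [IsProbabilityMeasure μ]
    {κ : Measure (S × S)} (h : κ ∈ couplings μ ν) : IsProbabilityMeasure κ := by
  have : IsProbabilityMeasure (κ.map Prod.fst) := by rw [h.1]; infer_instance
  exact Measure.isProbabilityMeasure_of_map (f := Prod.fst)

theorem prod_mem_couplings (μ ν : Measure S) [IsProbabilityMeasure μ] [IsProbabilityMeasure ν] :
    μ.prod ν ∈ couplings μ ν := by
  simp [couplings, Measure.map_fst_prod, Measure.map_snd_prod]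

theorem transportCost_le_lintegral {d : S → S → ℝ} {κ : Measure (S × S)} {g : S × S → ℝ≥0∞}
    (hg : Measurable g) (h : ∀ p, ENNReal.ofReal (d p.1 p.2) ≤ g p) :
    transportCost d κ ≤ ∫⁻ p, g p ∂κ :=
  iInf_le_of_le g (iInf_le_of_le hg (iInf_le_of_le h le_rfl))

/-- Adding `ε` to a measurable majorant of `d'` gives one of `d`, and `κ` has total mass one. -/
theorem transportCost_le_add {d d' : S → S → ℝ} {ε : ℝ} (h : ∀ x y, d x y ≤ d' x y + ε)
    (κ : Measure (S × S)) [IsProbabilityMeasure κ] :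
    transportCost d κ ≤ transportCost d' κ + ENNReal.ofReal ε := by
  conv_rhs => rw [transportCost]
  simp only [ENNReal.iInf_add]
  refine le_iInf fun g => le_iInf fun hg => le_iInf fun hgd => ?_
  calc transportCost d κ ≤ ∫⁻ p, (g p + ENNReal.ofReal ε) ∂κ :=
        transportCost_le_lintegral (hg.add_const _) fun p =>
          ((ENNReal.ofReal_le_ofReal (h p.1 p.2)).trans ENNReal.ofReal_add_le).trans
            (add_le_add_left (hgd p) _)
    _ = _ := by rw [lintegral_add_left hg]; simp

/-- The transport cost of an optimal coupling, before truncation to a real number. -/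
noncomputable def ewasserstein (d : S → S → ℝ) (μ ν : Measure S) : ℝ≥0∞ :=
  ⨅ κ ∈ couplings μ ν, transportCost d κ

theorem ewasserstein_le_ofReal {d : S → S → ℝ} {C : ℝ} (h : ∀ x y, d x y ≤ C) (μ ν : Measure S)
    [IsProbabilityMeasure μ] [IsProbabilityMeasure ν] :
    ewasserstein d μ ν ≤ ENNReal.ofReal C := by
  refine (iInf₂_le _ (prod_mem_couplings μ ν)).trans ?_
  refine (transportCost_le_lintegral measurable_const
    fun p => ENNReal.ofReal_le_ofReal (h p.1 p.2)).trans ?_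
  simp

/-- The product coupling has finite cost. Finiteness matters because `toReal` sends `∞` to `0`,
which would destroy the order estimates. -/
theorem ewasserstein_ne_top {d : S → S → ℝ} (hd : d ∈ met S) (μ ν : Measure S)
    [IsProbabilityMeasure μ] [IsProbabilityMeasure ν] : ewasserstein d μ ν ≠ ∞ := by
  obtain ⟨C, hC⟩ := hd.2.2.2
  exact ne_top_of_le_ne_top ENNReal.ofReal_ne_top (ewasserstein_le_ofReal hC μ ν)

theorem wasserstein_le_of_le {d : S → S → ℝ} (hd : d ∈ met S) {C : ℝ} (h : ∀ x y, d x y ≤ C)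
    (μ ν : Measure S) [IsProbabilityMeasure μ] [IsProbabilityMeasure ν] :
    wasserstein d μ ν ≤ C := by
  have hC : 0 ≤ C := by
    obtain ⟨x⟩ : Nonempty S := nonempty_of_isProbabilityMeasure μ
    exact (met_nonneg hd x x).trans (h x x)
  exact ENNReal.toReal_le_of_le_ofReal hC (ewasserstein_le_ofReal h μ ν)

theorem wasserstein_le_add {d d' : S → S → ℝ} (hd' : d' ∈ met S) {ε : ℝ} (hε : 0 ≤ ε)
    (h : ∀ x y, d x y ≤ d' x y + ε) (μ ν : Measure S)
    [IsProbabilityMeasure μ] [IsProbabilityMeasure ν] :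
    wasserstein d μ ν ≤ wasserstein d' μ ν + ε := by
  have key : ewasserstein d μ ν ≤ ewasserstein d' μ ν + ENNReal.ofReal ε := by
    conv_rhs => rw [ewasserstein]
    simp only [ENNReal.iInf_add]
    refine le_iInf₂ fun κ hκ => (iInf₂_le κ hκ).trans ?_
    have := isProbabilityMeasure_of_mem_couplings hκ
    exact transportCost_le_add h κ
  have hne := ewasserstein_ne_top hd' μ ν
  have := ENNReal.toReal_mono (ENNReal.add_ne_top.2 ⟨hne, ENNReal.ofReal_ne_top⟩) key
  rwa [ENNReal.toReal_add hne ENNReal.ofReal_ne_top, ENNReal.toReal_ofReal hε] at this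

theorem abs_wasserstein_sub_le {d d' : S → S → ℝ} (hd : d ∈ met S) (hd' : d' ∈ met S) {ε : ℝ}
    (hε : 0 ≤ ε) (h : ∀ x y, |d x y - d' x y| ≤ ε) (μ ν : Measure S)
    [IsProbabilityMeasure μ] [IsProbabilityMeasure ν] :
    |wasserstein d μ ν - wasserstein d' μ ν| ≤ ε := by
  have h1 := wasserstein_le_add (d := d) hd' hε (fun x y => by linarith [(abs_le.1 (h x y)).2]) μ ν
  have h2 := wasserstein_le_add (d := d') hd hε (fun x y => by linarith [(abs_le.1 (h x y)).1]) μ ν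
  exact abs_le.2 ⟨by linarith, by linarith⟩

theorem wasserstein_self [StandardBorelSpace S] {d : S → S → ℝ} (hd : d ∈ met S) (μ : Measure S) :
    wasserstein d μ μ = 0 := by
  classical
  have hdiag : Measurable fun x : S => (x, x) := measurable_id.prodMk measurable_id
  have hmem : μ.map (fun x => (x, x)) ∈ couplings μ μ := by
    constructor
    · rw [Measure.map_map measurable_fst hdiag]; exact Measure.map_id
    · rw [Measure.map_map measurable_snd hdiag]; exact Measure.map_id
  have hD : MeasurableSet (Set.diagonal S) := measurableSet_diagonal
  -- A measurable majorant of every pseudometric that vanishes on the diagonal, where the diagonal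
  -- coupling lives.
  set g : S × S → ℝ≥0∞ := (Set.diagonal S)ᶜ.indicator fun _ => ∞
  have hgm : Measurable g := measurable_const.indicator hD.compl
  have h0 : ewasserstein d μ μ ≤ 0 := by
    refine (iInf₂_le _ hmem).trans ((transportCost_le_lintegral hgm fun p => ?_).trans ?_)
    · by_cases hp : p.1 = p.2
      · simp [hp, hd.1]
      · have : p ∈ (Set.diagonal S)ᶜ := hp
        simp [g, Set.indicator_of_mem this]
    · rw [lintegral_map hgm hdiag]
      simp [g]
  show (ewasserstein d μ μ).toReal = 0
  rw [nonpos_iff_eq_zero.1 h0, ENNReal.toReal_zero]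

theorem ewasserstein_comm_le {d : S → S → ℝ} (hd : ∀ x y, d x y = d y x) (μ ν : Measure S) :
    ewasserstein d μ ν ≤ ewasserstein d ν μ := by
  refine le_iInf₂ fun κ hκ => ?_
  have hmem : κ.map Prod.swap ∈ couplings μ ν := by
    constructor
    · rw [Measure.map_map measurable_fst measurable_swap]; exact hκ.2
    · rw [Measure.map_map measurable_snd measurable_swap]; exact hκ.1
  refine (iInf₂_le _ hmem).trans ?_
  refine le_iInf fun g => le_iInf fun hg => le_iInf fun hgd => ?_
  refine (transportCost_le_lintegral (hg.comp measurable_swap)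
    fun p => by simpa [hd p.1 p.2] using hgd p.swap).trans_eq ?_
  rw [lintegral_map (hg.comp measurable_swap) measurable_swap]
  simp

theorem wasserstein_comm {d : S → S → ℝ} (hd : ∀ x y, d x y = d y x) (μ ν : Measure S) :
    wasserstein d μ ν = wasserstein d ν μ :=
  congrArg ENNReal.toReal
    (le_antisymm (ewasserstein_comm_le hd μ ν) (ewasserstein_comm_le hd ν μ))

/-- Gluing of two couplings along their common marginal. -/
theorem exists_glue [StandardBorelSpace S] {μ ν ρ : Measure S} [IsProbabilityMeasure ν]
    {κ₁ κ₂ : Measure (S × S)} [IsProbabilityMeasure κ₁]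
    [IsProbabilityMeasure κ₂] (h₁ : κ₁ ∈ couplings μ ν) (h₂ : κ₂ ∈ couplings ν ρ) :
    ∃ η : Measure ((S × S) × S), IsProbabilityMeasure η ∧ η.map Prod.fst = κ₁ ∧
      η.map (fun p => (p.1.2, p.2)) = κ₂ := by
  have : Nonempty S := nonempty_of_isProbabilityMeasure ν
  -- Draw a pair from `κ₁`, then a third point from the conditional law of `κ₂` given the middle
  -- one.
  refine ⟨κ₁ ⊗ₘ (κ₂.condKernel.comap Prod.snd measurable_snd), inferInstance,
    Measure.fst_compProd _ _, ?_⟩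
  have hm : Measurable fun p : (S × S) × S => (p.1.2, p.2) := by fun_prop
  refine Measure.ext_of_lintegral _ fun f hf => ?_
  rw [lintegral_map hf hm,
    Measure.lintegral_compProd (f := fun p : (S × S) × S => f (p.1.2, p.2)) (hf.comp hm)]
  simp only [Kernel.comap_apply]
  rw [← lintegral_map (μ := κ₁) (f := fun y => ∫⁻ z, f (y, z) ∂κ₂.condKernel y) (g := Prod.snd)
    hf.lintegral_kernel_prod_right' measurable_snd, h₁.2, ← h₂.1]
  conv_rhs => rw [← κ₂.disintegrate κ₂.condKernel, Measure.lintegral_compProd hf]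
  rfl

/-- Given the glued law of `(x, y, z)`, majorants `g₁` and `g₂` bound `d x z` only through a sum
depending on `y`. Averaging that sum over the conditional law of `y` given `(x, z)` yields a
measurable majorant on pairs with the same total integral. -/
theorem ewasserstein_triangle [StandardBorelSpace S] {d : S → S → ℝ} (hd : d ∈ met S)
    (μ ν ρ : Measure S) [IsProbabilityMeasure μ] [IsProbabilityMeasure ν] :
    ewasserstein d μ ρ ≤ ewasserstein d μ ν + ewasserstein d ν ρ := by
  have : Nonempty S := nonempty_of_isProbabilityMeasure ν
  simp only [ewasserstein]
  refine ENNReal.le_iInf₂_add_iInf₂ fun κ₁ h₁ κ₂ h₂ => ?_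
  have := isProbabilityMeasure_of_mem_couplings h₁
  have := isProbabilityMeasure_of_mem_couplings h₂
  obtain ⟨η, _, hη₁, hη₂⟩ := exists_glue h₁ h₂
  have hm : Measurable fun p : (S × S) × S => (p.1.2, p.2) := by fun_prop
  have he : Measurable fun p : (S × S) × S => ((p.1.1, p.2), p.1.2) := by fun_prop
  -- The middle point is moved last, so that `θ` can be disintegrated over the outer pair.
  set θ : Measure ((S × S) × S) := η.map fun p => ((p.1.1, p.2), p.1.2) with hθ
  have : IsProbabilityMeasure θ := Measure.isProbabilityMeasure_map he.aemeasurable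
  have hmem : θ.fst ∈ couplings μ ρ := by
    constructor
    · rw [Measure.fst, hθ, Measure.map_map measurable_fst he,
        Measure.map_map measurable_fst (measurable_fst.comp he), ← h₁.1, ← hη₁,
        Measure.map_map measurable_fst measurable_fst]
      rfl
    · rw [Measure.fst, hθ, Measure.map_map measurable_fst he,
        Measure.map_map measurable_snd (measurable_fst.comp he), ← h₂.2, ← hη₂,
        Measure.map_map measurable_snd hm]
      rfl
  refine (iInf₂_le _ hmem).trans ?_
  conv_rhs => rw [transportCost, transportCost]
  simp only [ENNReal.iInf_add, ENNReal.add_iInf]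
  refine le_iInf fun g₂ => le_iInf fun hg₂ => le_iInf fun hd₂ =>
    le_iInf fun g₁ => le_iInf fun hg₁ => le_iInf fun hd₁ => ?_
  set h : (S × S) × S → ℝ≥0∞ := fun q => g₁ (q.1.1, q.2) + g₂ (q.2, q.1.2)
  have hhm : Measurable h := by fun_prop
  refine (transportCost_le_lintegral (g := fun p => ∫⁻ y, h (p, y) ∂θ.condKernel p)
    hhm.lintegral_kernel_prod_right' fun p => ?_).trans_eq ?_
  · calc ENNReal.ofReal (d p.1 p.2) = ∫⁻ _, ENNReal.ofReal (d p.1 p.2) ∂θ.condKernel p := by simp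
      _ ≤ _ := lintegral_mono fun y =>
        ((ENNReal.ofReal_le_ofReal (hd.2.2.1 p.1 y p.2)).trans ENNReal.ofReal_add_le).trans
          (add_le_add (hd₁ (p.1, y)) (hd₂ (y, p.2)))
  · rw [← Measure.lintegral_compProd hhm, θ.disintegrate θ.condKernel, hθ, lintegral_map hhm he,
      ← hη₁, ← hη₂, lintegral_map hg₁ measurable_fst, lintegral_map hg₂ hm,
      ← lintegral_add_left (f := fun p : (S × S) × S => g₁ p.1) (hg₁.comp measurable_fst)]

theorem wasserstein_triangle [StandardBorelSpace S] {d : S → S → ℝ} (hd : d ∈ met S)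
    (μ ν ρ : Measure S) [IsProbabilityMeasure μ] [IsProbabilityMeasure ν]
    [IsProbabilityMeasure ρ] :
    wasserstein d μ ρ ≤ wasserstein d μ ν + wasserstein d ν ρ := by
  have h1 := ewasserstein_ne_top hd μ ν
  have h2 := ewasserstein_ne_top hd ν ρ
  have := ENNReal.toReal_mono (ENNReal.add_ne_top.2 ⟨h1, h2⟩) (ewasserstein_triangle hd μ ν ρ)
  rwa [ENNReal.toReal_add h1 h2] at this

end Wasserstein

/-! ### Bounded measurable functions and policy evaluation -/

variable {S A : Type*} [MeasurableSpace S] [MeasurableSpace A]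

/-- The bounded measurable functions on the state space. -/
def boundedMeasurable (S : Type*) [MeasurableSpace S] : Set (S → ℝ) :=
  {V | Measurable V ∧ ∃ C : ℝ, ∀ s, |V s| ≤ C}

theorem integrable_of_boundedMeasurable {V : S → ℝ} (hV : V ∈ boundedMeasurable S) (μ : Measure S)
    [IsFiniteMeasure μ] : Integrable V μ := by
  obtain ⟨C, hC⟩ := hV.2
  exact Integrable.of_bound hV.1.aestronglyMeasurable C (.of_forall hC)

theorem abs_integral_le_of_abs_le {V : S → ℝ} {C : ℝ} (h : ∀ s, |V s| ≤ C) (μ : Measure S)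
    [IsProbabilityMeasure μ] : |∫ s, V s ∂μ| ≤ C := by
  simpa using norm_integral_le_of_norm_le_const (μ := μ) (f := V) (.of_forall h)

theorem integral_le_integral_add {V W : S → ℝ} (hV : V ∈ boundedMeasurable S)
    (hW : W ∈ boundedMeasurable S) {m : ℝ} (h : ∀ s, V s ≤ W s + m) (μ : Measure S)
    [IsProbabilityMeasure μ] : ∫ s, V s ∂μ ≤ ∫ s, W s ∂μ + m := by
  have hi := integrable_of_boundedMeasurable hW μ
  calc ∫ s, V s ∂μ ≤ ∫ s, (W s + m) ∂μ :=
        integral_mono (integrable_of_boundedMeasurable hV μ) (hi.add (integrable_const m)) h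
    _ = _ := by rw [integral_add hi (integrable_const m)]; simp

theorem mem_boundedMeasurable_of_tendstoUniformly {u : ℕ → S → ℝ} {V : S → ℝ}
    (hu : ∀ n, u n ∈ boundedMeasurable S) (h : TendstoUniformly u V atTop) :
    V ∈ boundedMeasurable S := by
  refine ⟨measurable_of_tendsto_metrizable (fun n => (hu n).1)
    (tendsto_pi_nhds.2 fun s => h.tendsto_at s), ?_⟩
  obtain ⟨n, hn⟩ := ((Metric.tendstoUniformly_iff.1 h) 1 one_pos).exists
  obtain ⟨C, hC⟩ := (hu n).2
  refine ⟨C + 1, fun s => ?_⟩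
  have h1 := hn s
  rw [Real.dist_eq] at h1
  calc |V s| = |u n s + (V s - u n s)| := by ring_nf
    _ ≤ |u n s| + |V s - u n s| := abs_add_le _ _
    _ ≤ C + 1 := add_le_add (hC s) h1.le

namespace MDP

variable (M : MDP S A)

instance : IsMarkovKernel M.trans := M.markov_trans

instance (π : Policy S A) : IsMarkovKernel (π.1 : Kernel S A) := π.2

instance (π : Policy S A) : IsMarkovKernel (M.policyTrans π) := by
  unfold policyTrans; infer_instance

theorem policyReward_mem (π : Policy S A) : M.policyReward π ∈ boundedMeasurable S := by
  obtain ⟨C, hC⟩ := M.bounded_reward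
  exact ⟨(M.measurable_reward.stronglyMeasurable.integral_kernel_prod_right' (κ := π.1)).measurable,
    C, fun s => abs_integral_le_of_abs_le (hC s) _⟩

theorem exists_abs_expReward_le (π : Policy S A) : ∃ C, ∀ t s, |M.expReward π t s| ≤ C := by
  obtain ⟨C, hC⟩ := (M.policyReward_mem π).2
  refine ⟨C, fun t => ?_⟩
  induction t with
  | zero => exact hC
  | succ t ih => exact fun s => abs_integral_le_of_abs_le ih _

theorem measurable_expReward (π : Policy S A) (t : ℕ) : Measurable (M.expReward π t) := by
  induction t with
  | zero => exact (M.policyReward_mem π).1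
  | succ t ih => exact (ih.stronglyMeasurable.integral_kernel (κ := M.policyTrans π)).measurable

/-- The Bellman operator of a policy. -/
noncomputable def policyOp (π : Policy S A) (V : S → ℝ) (s : S) : ℝ :=
  M.policyReward π s + M.disc * ∫ s', V s' ∂(M.policyTrans π s)

theorem abs_discounted_expReward_le {π : Policy S A} {C : ℝ}
    (hC : ∀ t s, |M.expReward π t s| ≤ C) (t : ℕ) (s : S) :
    ‖M.disc ^ t * M.expReward π t s‖ ≤ M.disc ^ t * C := by
  rw [Real.norm_eq_abs, abs_mul, abs_of_nonneg (pow_nonneg M.disc_nonneg t)]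
  exact mul_le_mul_of_nonneg_left (hC t s) (pow_nonneg M.disc_nonneg t)

theorem summable_disc_pow_mul (C : ℝ) : Summable fun t : ℕ => M.disc ^ t * C :=
  (summable_geometric_of_lt_one M.disc_nonneg M.disc_lt_one).mul_right C

theorem summable_value (π : Policy S A) (s : S) :
    Summable fun t : ℕ => M.disc ^ t * M.expReward π t s := by
  obtain ⟨C, hC⟩ := M.exists_abs_expReward_le π
  exact .of_norm_bounded (M.summable_disc_pow_mul C) fun t => M.abs_discounted_expReward_le hC t s

theorem value_mem (π : Policy S A) : M.value π ∈ boundedMeasurable S := by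
  obtain ⟨C, hC⟩ := M.exists_abs_expReward_le π
  refine ⟨Measurable.tsum fun t => (M.measurable_expReward π t).const_mul _,
    ∑' t : ℕ, M.disc ^ t * C, fun s => ?_⟩
  exact tsum_of_norm_bounded (M.summable_disc_pow_mul C).hasSum
    fun t => M.abs_discounted_expReward_le hC t s

/-- Integrating the discounted series term by term, by absolute summability, shifts time by one. -/
theorem policyOp_value (π : Policy S A) : M.policyOp π (M.value π) = M.value π := by
  obtain ⟨C, hC⟩ := M.exists_abs_expReward_le π
  funext s
  have hint : ∫ s', M.value π s' ∂(M.policyTrans π s) =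
      ∑' t : ℕ, M.disc ^ t * M.expReward π (t + 1) s := by
    have hi : ∀ t : ℕ, Integrable (fun s' => M.disc ^ t * M.expReward π t s')
        (M.policyTrans π s) := fun t =>
      (integrable_of_boundedMeasurable ⟨M.measurable_expReward π t, C, hC t⟩ _).const_mul _
    have h := hasSum_integral_of_summable_integral_norm hi
      (.of_nonneg_of_le (fun t => integral_nonneg fun _ => norm_nonneg _) (fun t => by
        simpa using integral_mono (hi t).norm (integrable_const (μ := M.policyTrans π s)
          (M.disc ^ t * C)) fun s' => M.abs_discounted_expReward_le hC t s')
        (M.summable_disc_pow_mul C))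
    refine h.tsum_eq.symm.trans (tsum_congr fun t => ?_)
    rw [integral_const_mul]
    rfl
  rw [policyOp, hint, value, (M.summable_value π s).tsum_eq_zero_add, ← tsum_mul_left]
  simp only [pow_zero, one_mul, expReward, pow_succ', mul_assoc]

theorem measurable_lookahead {V : S → ℝ} (hV : V ∈ boundedMeasurable S) :
    Measurable fun p : S × A => M.lookahead V p.1 p.2 :=
  M.measurable_reward.add
    ((hV.1.stronglyMeasurable.integral_kernel (κ := M.trans)).measurable.const_mul _)

theorem exists_abs_lookahead_le {V : S → ℝ} (hV : V ∈ boundedMeasurable S) :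
    ∃ C, ∀ s a, |M.lookahead V s a| ≤ C := by
  obtain ⟨C, hC⟩ := M.bounded_reward
  obtain ⟨D, hD⟩ := hV.2
  refine ⟨C + M.disc * D, fun s a => (abs_add_le _ _).trans (add_le_add (hC s a) ?_)⟩
  rw [abs_mul, abs_of_nonneg M.disc_nonneg]
  exact mul_le_mul_of_nonneg_left (abs_integral_le_of_abs_le hD _) M.disc_nonneg

theorem integral_policyTrans (π : Policy S A) {V : S → ℝ} (hV : V ∈ boundedMeasurable S) (s : S) :
    ∫ s', V s' ∂(M.policyTrans π s) = ∫ a, ∫ s', V s' ∂(M.trans (s, a)) ∂(π.1 s) := by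
  obtain ⟨C, hC⟩ := hV.2
  rw [policyTrans, Kernel.snd_apply, integral_map measurable_snd.aemeasurable
    hV.1.aestronglyMeasurable]
  exact integral_compProd (f := fun p : A × S => V p.2)
    (.of_bound (hV.1.comp measurable_snd).aestronglyMeasurable C (.of_forall fun p => hC p.2))

theorem integral_lookahead (π : Policy S A) {V : S → ℝ} (hV : V ∈ boundedMeasurable S) (s : S) :
    ∫ a, M.lookahead V s a ∂(π.1 s) = M.policyOp π V s := by
  have hs : Measurable fun a : A => (s, a) := measurable_const.prodMk measurable_id
  obtain ⟨C, hC⟩ := M.bounded_reward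
  obtain ⟨D, hD⟩ := hV.2
  have h1 : Integrable (fun a => M.reward s a) (π.1 s) :=
    integrable_of_boundedMeasurable ⟨M.measurable_reward.comp hs, C, hC s⟩ _
  have h2 : Integrable (fun a => ∫ s', V s' ∂(M.trans (s, a))) (π.1 s) :=
    integrable_of_boundedMeasurable
      ⟨(hV.1.stronglyMeasurable.integral_kernel (κ := M.trans)).measurable.comp hs, D,
        fun a => abs_integral_le_of_abs_le hD _⟩ _
  rw [policyOp, M.integral_policyTrans π hV, policyReward, ← integral_const_mul,
    ← integral_add h1 (h2.const_mul _)]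
  rfl

theorem lookahead_le_add {V W : S → ℝ} (hV : V ∈ boundedMeasurable S)
    (hW : W ∈ boundedMeasurable S) {m : ℝ} (h : ∀ s, V s ≤ W s + m) (s : S) (a : A) :
    M.lookahead V s a ≤ M.lookahead W s a + M.disc * m := by
  have := mul_le_mul_of_nonneg_left (integral_le_integral_add hV hW h (M.trans (s, a)))
    M.disc_nonneg
  rw [lookahead, lookahead]
  linarith

theorem policyOp_le_add (π : Policy S A) {V W : S → ℝ} (hV : V ∈ boundedMeasurable S)
    (hW : W ∈ boundedMeasurable S) {m : ℝ} (h : ∀ s, V s ≤ W s + m) (s : S) :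
    M.policyOp π V s ≤ M.policyOp π W s + M.disc * m := by
  have := mul_le_mul_of_nonneg_left (integral_le_integral_add hV hW h (M.policyTrans π s))
    M.disc_nonneg
  rw [policyOp, policyOp]
  linarith

/-- Comparison principle: an upper bound `m` for `V - W` improves to `γ m`, since the policy
operator is monotone and discounts constants. -/
theorem le_of_le_policyOp (π : Policy S A) {V W : S → ℝ} (hV : V ∈ boundedMeasurable S)
    (hW : W ∈ boundedMeasurable S) (h1 : ∀ s, V s ≤ M.policyOp π V s)
    (h2 : ∀ s, M.policyOp π W s ≤ W s) (s : S) : V s ≤ W s := by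
  obtain ⟨C, hC⟩ := hV.2
  obtain ⟨D, hD⟩ := hW.2
  refine sub_nonpos.1 (nonpos_of_improving_bound (f := fun s => V s - W s) M.disc_nonneg
    M.disc_lt_one ⟨C + D, fun s => ?_⟩ (fun m _ hm s => ?_) s)
  · linarith [(abs_le.1 (hC s)).2, (abs_le.1 (hD s)).1]
  · have := M.policyOp_le_add π hV hW (m := m) (fun s => by linarith [hm s]) s
    linarith [h1 s, h2 s]

theorem le_value (π : Policy S A) {V : S → ℝ} (hV : V ∈ boundedMeasurable S)
    (h : ∀ s, V s ≤ M.policyOp π V s) (s : S) : V s ≤ M.value π s :=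
  M.le_of_le_policyOp π hV (M.value_mem π) h (fun s => (congrFun (M.policyOp_value π) s).le) s

theorem value_le (π : Policy S A) {V : S → ℝ} (hV : V ∈ boundedMeasurable S)
    (h : ∀ s, M.policyOp π V s ≤ V s) (s : S) : M.value π s ≤ V s :=
  M.le_of_le_policyOp π (M.value_mem π) hV (fun s => (congrFun (M.policyOp_value π) s).ge) h s

variable {M}

/-! ### Bellman optimality and policy iteration -/

namespace ArgmaxRule

variable (G : M.ArgmaxRule)

/-- The deterministic policy that is greedy with respect to `V`. -/
noncomputable def greedy (V : S → ℝ) : Policy S A :=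
  ⟨Kernel.deterministic (G.toFun V) (G.measurable_toFun _), inferInstance⟩

theorem improve_eq_greedy (π : Policy S A) : G.improve π = G.greedy (M.value π) := rfl

/-- The Bellman optimality operator. -/
noncomputable def bellman (V : S → ℝ) (s : S) : ℝ := M.lookahead V s (G.toFun V s)

theorem policyOp_greedy {V : S → ℝ} (hV : V ∈ boundedMeasurable S) :
    M.policyOp (G.greedy V) V = G.bellman V := by
  funext s
  have hs : Measurable fun a : A => (s, a) := measurable_const.prodMk measurable_id
  rw [← M.integral_lookahead _ hV]
  exact Kernel.integral_deterministic' (G.measurable_toFun V)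
    ((M.measurable_lookahead hV).comp hs).stronglyMeasurable

theorem policyOp_le_bellman (π : Policy S A) {V : S → ℝ} (hV : V ∈ boundedMeasurable S) (s : S) :
    M.policyOp π V s ≤ G.bellman V s := by
  have hs : Measurable fun a : A => (s, a) := measurable_const.prodMk measurable_id
  obtain ⟨C, hC⟩ := M.exists_abs_lookahead_le hV
  rw [← M.integral_lookahead _ hV]
  simpa using integral_mono (μ := π.1 s) (integrable_of_boundedMeasurable
    ⟨(M.measurable_lookahead hV).comp hs, C, hC s⟩ _) (integrable_const (G.bellman V s))
    (G.is_argmax V hV.1 hV.2 s)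

/-- The action greedy for `V` is merely a competitor in the maximum for `W`. -/
theorem bellman_le_add {V W : S → ℝ} (hV : V ∈ boundedMeasurable S)
    (hW : W ∈ boundedMeasurable S) {m : ℝ} (h : ∀ s, V s ≤ W s + m) (s : S) :
    G.bellman V s ≤ G.bellman W s + M.disc * m :=
  (M.lookahead_le_add hV hW h s _).trans (by simpa using! G.is_argmax W hW.1 hW.2 s _)

theorem supContraction_bellman : SupContraction (boundedMeasurable S) G.bellman M.disc where
  nonneg := M.disc_nonneg
  lt_one := M.disc_lt_one
  bounded _ h := h.2
  mapsTo V hV := by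
    obtain ⟨C, hC⟩ := M.exists_abs_lookahead_le hV
    exact ⟨(M.measurable_lookahead hV).comp (measurable_id.prodMk (G.measurable_toFun V)), C,
      fun s => hC s _⟩
  contract V hV W hW ε _ h s := by
    have h1 := G.bellman_le_add hV hW (m := ε) (fun s => by linarith [(abs_le.1 (h s)).2]) s
    have h2 := G.bellman_le_add hW hV (m := ε) (fun s => by linarith [(abs_le.1 (h s)).1]) s
    exact abs_le.2 ⟨by linarith, by linarith⟩

theorem exists_bellman_fixed : ∃ V ∈ boundedMeasurable S, G.bellman V = V :=
  G.supContraction_bellman.exists_fixed ⟨0, measurable_zero, 0, by simp⟩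
    fun _ hu _ h => mem_boundedMeasurable_of_tendstoUniformly hu h

section Optimal

variable {V : S → ℝ} (hV : V ∈ boundedMeasurable S) (hfix : G.bellman V = V)
include hV hfix

theorem value_greedy_of_fixed : M.value (G.greedy V) = V := by
  have h := (G.policyOp_greedy hV).trans hfix
  funext s
  exact le_antisymm (M.value_le _ hV (fun s => (congrFun h s).le) s)
    (M.le_value _ hV (fun s => (congrFun h s).ge) s)

theorem value_le_of_fixed (π : Policy S A) (s : S) : M.value π s ≤ V s :=
  M.value_le π hV (fun s => (G.policyOp_le_bellman π hV s).trans_eq (congrFun hfix s)) s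

/-- A policy fixed by improvement has a Bellman-fixed value, hence value `V`. The fixed tie-breaking
then determines the policy itself and not only its value. -/
theorem improve_eq_self_iff (π : Policy S A) : G.improve π = π ↔ π = G.greedy V := by
  constructor
  · intro h
    have h1 : G.bellman (M.value π) = M.value π := by
      rw [← G.policyOp_greedy (M.value_mem π), ← G.improve_eq_greedy, h, M.policyOp_value]
    rw [← h, G.improve_eq_greedy,
      G.supContraction_bellman.eq_of_fixed (M.value_mem π) hV h1 hfix]
  · rintro rfl
    rw [improve_eq_greedy, G.value_greedy_of_fixed hV hfix]

end Optimal

theorem value_le_bellman (π : Policy S A) (s : S) : M.value π s ≤ G.bellman (M.value π) s := by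
  conv_lhs => rw [← M.policyOp_value π]
  exact G.policyOp_le_bellman π (M.value_mem π) s

theorem value_le_value_improve (π : Policy S A) (s : S) :
    M.value π s ≤ M.value (G.improve π) s := by
  refine M.le_value _ (M.value_mem π) (fun s => ?_) s
  rw [improve_eq_greedy, G.policyOp_greedy (M.value_mem π)]
  exact G.value_le_bellman π s

theorem bellman_value_le_value_improve (π : Policy S A) (s : S) :
    G.bellman (M.value π) s ≤ M.value (G.improve π) s := by
  rw [← M.policyOp_value (G.improve π), ← G.policyOp_greedy (M.value_mem π), ← improve_eq_greedy]
  -- With `m = 0` this is monotonicity of the policy operator.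
  simpa using M.policyOp_le_add (G.improve π) (M.value_mem π) (M.value_mem (G.improve π)) (m := 0)
    (by simpa using G.value_le_value_improve π) s

theorem policyIter_succ (π₀ : Policy S A) (k : ℕ) :
    G.policyIter π₀ (k + 1) = G.improve (G.policyIter π₀ k) :=
  Function.iterate_succ_apply' _ _ _

/-- A Bellman step multiplies the bound on the gap to `V` by `γ`, and the improved policy is at
least as good as that step. -/
theorem tendstoUniformly_value_policyIter {V : S → ℝ} (hV : V ∈ boundedMeasurable S)
    (hfix : G.bellman V = V) (π₀ : Policy S A) :
    TendstoUniformly (fun k => M.value (G.policyIter π₀ k)) V atTop := by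
  obtain ⟨B, -, hB⟩ := G.supContraction_bellman.exists_abs_sub_le (M.value_mem π₀) hV
  have key : ∀ k s, V s ≤ M.value (G.policyIter π₀ k) s + M.disc ^ k * B := by
    intro k
    induction k with
    | zero => intro s; simpa [policyIter] using by linarith [(abs_le.1 (hB s)).1]
    | succ k ih =>
      intro s
      have h1 := G.bellman_le_add hV (M.value_mem _) ih s
      have h2 := G.bellman_value_le_value_improve (G.policyIter π₀ k) s
      rw [hfix] at h1
      rw [policyIter_succ, pow_succ', mul_assoc]
      linarith
  refine tendstoUniformly_of_le_geometric (B := B) M.disc_nonneg M.disc_lt_one fun k s => ?_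
  have h1 := key k s
  have h2 := G.value_le_of_fixed hV hfix (G.policyIter π₀ k) s
  rw [abs_le]
  constructor <;> linarith

theorem eventually_policyIter_eq [Finite S] [Finite A] {V : S → ℝ}
    (hV : V ∈ boundedMeasurable S) (hfix : G.bellman V = V) (π₀ : Policy S A) :
    ∀ᶠ k in atTop, G.policyIter π₀ k = G.greedy V := by
  -- The shift by one discards `π₀`, which may be randomized; all later policies are greedy.
  set D : Set (S → ℝ) := Set.range fun k => M.value (G.policyIter π₀ (k + 1))
  have hrange : (Set.range G.toFun).Finite := Set.toFinite _
  have hgr : (Set.range G.greedy).Finite := by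
    -- A greedy policy depends on its function only through the selector `S → A`, of which there are
    -- finitely many.
    choose! W hW using fun f (hf : f ∈ Set.range G.toFun) => hf
    refine (hrange.image fun f => G.greedy (W f)).subset ?_
    rintro _ ⟨U, rfl⟩
    refine ⟨G.toFun U, ⟨U, rfl⟩, ?_⟩
    have := hW (G.toFun U) ⟨U, rfl⟩
    exact Subtype.ext (by simp only [greedy, this])
  have hfin : D.Finite := by
    refine (hgr.image M.value).subset ?_
    rintro _ ⟨k, rfl⟩
    exact ⟨_, ⟨M.value (G.policyIter π₀ k), rfl⟩, by simp only [policyIter_succ]; rfl⟩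
  have hlim : Tendsto (fun k => M.value (G.policyIter π₀ (k + 1))) atTop (nhds V) :=
    (tendsto_add_atTop_iff_nat (f := fun k => M.value (G.policyIter π₀ k)) 1).2
      (tendsto_pi_nhds.2 fun s => (G.tendstoUniformly_value_policyIter hV hfix π₀).tendsto_at s)
  -- A finite set is closed, so values close enough to `V` must equal `V`.
  have hopen : (D \ {V})ᶜ ∈ nhds V :=
    (hfin.subset Set.sdiff_subset).isClosed.isOpen_compl.mem_nhds (by simp)
  obtain ⟨N, hN⟩ := eventually_atTop.1 (hlim.eventually hopen)
  refine eventually_atTop.2 ⟨N + 2, fun k hk => ?_⟩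
  -- One step reaches the range of `D`; the other turns equality of values into equality of
  -- policies.
  obtain ⟨j, rfl⟩ : ∃ j, k = N + j + 1 + 1 := ⟨k - N - 2, by omega⟩
  have h1 : M.value (G.policyIter π₀ (N + j + 1)) = V := by
    by_contra h
    exact hN (N + j) (by omega) ⟨⟨N + j, rfl⟩, h⟩
  rw [policyIter_succ, improve_eq_greedy, h1]

end ArgmaxRule

/-! ### Bisimulation metrics as fixed points -/

section Metric

variable [StandardBorelSpace S] (M)

theorem bisimOp_mem_met {c : ℝ} (hc0 : 0 ≤ c) (hc1 : c < 1) (π : Policy S A) {d : S → S → ℝ}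
    (hd : d ∈ met S) : M.bisimOp c d π ∈ met S := by
  have hc' : 0 ≤ 1 - c := by linarith
  refine ⟨fun x => ?_, fun x y => ?_, fun x y z => ?_, ?_⟩
  · simp [bisimOp, wasserstein_self hd]
  · rw [bisimOp, bisimOp, abs_sub_comm, wasserstein_comm hd.2.1]
  · have h1 := mul_le_mul_of_nonneg_left (abs_sub_le (M.policyReward π x) (M.policyReward π y)
      (M.policyReward π z)) hc'
    have h2 := mul_le_mul_of_nonneg_left (wasserstein_triangle hd (M.policyTrans π x)
      (M.policyTrans π y) (M.policyTrans π z)) hc0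
    simp only [bisimOp]
    linarith
  · obtain ⟨C, hC⟩ := hd.2.2.2
    obtain ⟨D, hD⟩ := (M.policyReward_mem π).2
    refine ⟨(1 - c) * (D + D) + c * C, fun x y => add_le_add
      (mul_le_mul_of_nonneg_left ?_ hc') (mul_le_mul_of_nonneg_left ?_ hc0)⟩
    · exact (abs_sub _ _).trans (add_le_add (hD x) (hD y))
    · exact wasserstein_le_of_le hd hC _ _

/-- The bounded pseudometrics, as functions on pairs. -/
def pairMet (S : Type*) : Set (S × S → ℝ) := {f | (fun x y => f (x, y)) ∈ met S}

theorem supContraction_bisimOp {c : ℝ} (hc0 : 0 ≤ c) (hc1 : c < 1) (π : Policy S A) :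
    SupContraction (pairMet S) (fun f p => M.bisimOp c (fun x y => f (x, y)) π p.1 p.2) c where
  nonneg := hc0
  lt_one := hc1
  bounded f hf := by
    obtain ⟨C, hC⟩ := hf.2.2.2
    exact ⟨C, fun p => abs_le.2 ⟨by linarith [met_nonneg (d := fun x y => f (x, y)) hf p.1 p.2, hC p.1 p.2], hC p.1 p.2⟩⟩
  mapsTo f hf := M.bisimOp_mem_met hc0 hc1 π hf
  contract f hf g hg ε hε h p := by
    simp only [bisimOp]
    -- The reward terms cancel, leaving `c` times a difference of Wasserstein distances.
    rw [add_sub_add_left_eq_sub, ← mul_sub, abs_mul, abs_of_nonneg hc0]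
    exact mul_le_mul_of_nonneg_left
      (abs_wasserstein_sub_le hf hg hε (fun x y => h (x, y)) _ _) hc0

theorem pairMet_of_tendstoUniformly {S : Type*} {u : ℕ → S × S → ℝ} {f : S × S → ℝ}
    (hu : ∀ n, u n ∈ pairMet S) (h : TendstoUniformly u f atTop) : f ∈ pairMet S := by
  have ht := fun p => h.tendsto_at p
  refine ⟨fun x => ?_, fun x y => ?_, fun x y z => ?_, ?_⟩
  · exact tendsto_nhds_unique (ht (x, x)) (by simp [fun n => (hu n).1 x])
  · exact tendsto_nhds_unique (ht (x, y)) ((ht (y, x)).congr fun n => (hu n).2.1 y x)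
  · exact le_of_tendsto_of_tendsto' (ht (x, z)) ((ht (x, y)).add (ht (y, z)))
      fun n => (hu n).2.2.1 x y z
  · obtain ⟨n, hn⟩ := ((Metric.tendstoUniformly_iff.1 h) 1 one_pos).exists
    obtain ⟨C, hC⟩ := (hu n).2.2.2
    refine ⟨C + 1, fun x y => ?_⟩
    have h1 := hn (x, y)
    rw [Real.dist_eq] at h1
    linarith [(abs_lt.1 h1).2, hC x y]

theorem bisimOp_fixed_unique {c : ℝ} (hc0 : 0 ≤ c) (hc1 : c < 1) (π : Policy S A)
    {d d' : S → S → ℝ} (hd : d ∈ met S) (hd' : d' ∈ met S) (h : M.bisimOp c d π = d)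
    (h' : M.bisimOp c d' π = d') : d = d' := by
  have := (M.supContraction_bisimOp hc0 hc1 π).eq_of_fixed (f := fun p => d p.1 p.2)
    (g := fun p => d' p.1 p.2) hd hd' (funext fun p => congrFun₂ h p.1 p.2)
    (funext fun p => congrFun₂ h' p.1 p.2)
  funext x y
  exact congrFun this (x, y)

theorem exists_bisimOp_fixed {c : ℝ} (hc0 : 0 ≤ c) (hc1 : c < 1) (π : Policy S A) :
    ∃ d ∈ met S, M.bisimOp c d π = d := by
  obtain ⟨f, hf, hfix⟩ := (M.supContraction_bisimOp hc0 hc1 π).exists_fixed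
    ⟨0, by simp, by simp, by simp, 0, by simp⟩ fun _ hu _ h => pairMet_of_tendstoUniformly hu h
  exact ⟨fun x y => f (x, y), hf, funext₂ fun x y => congrFun hfix (x, y)⟩

theorem metricIter_mem_met {c : ℝ} (hc0 : 0 ≤ c) (hc1 : c < 1) (π : ℕ → Policy S A)
    {d₀ : S → S → ℝ} (hd₀ : d₀ ∈ met S) (n : ℕ) : M.metricIter c π d₀ n ∈ met S := by
  induction n with
  | zero => exact hd₀
  | succ n ih => exact M.bisimOp_mem_met hc0 hc1 _ ih

theorem tendstoUniformly_metricIter {c : ℝ} (hc0 : 0 ≤ c) (hc1 : c < 1) {π : ℕ → Policy S A}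
    {πlim : Policy S A} (hπ : ∀ᶠ k in atTop, π k = πlim) {d₀ d : S → S → ℝ} (hd₀ : d₀ ∈ met S)
    (hd : d ∈ met S) (hfix : M.bisimOp c d πlim = d) :
    TendstoUniformly (fun n (p : S × S) => M.metricIter c π d₀ n p.1 p.2)
      (fun p : S × S => d p.1 p.2) atTop := by
  have hmem : ∀ n, (fun p : S × S => M.metricIter c π d₀ n p.1 p.2) ∈ pairMet S :=
    fun n => M.metricIter_mem_met hc0 hc1 π hd₀ n
  refine (M.supContraction_bisimOp hc0 hc1 πlim).tendstoUniformly (f := fun p => d p.1 p.2) hd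
    (funext fun p => congrFun₂ hfix p.1 p.2) hmem ?_
  filter_upwards [hπ] with n hn
  rw [← hn]
  rfl

end Metric

end MDP

end BisimControl

theorem theorem1 {S A : Type*} [MeasurableSpace S] [StandardBorelSpace S] [MeasurableSpace A]
    (M : BisimControl.MDP S A) (G : M.ArgmaxRule) (c : ℝ) (hc0 : 0 ≤ c) (hc1 : c < 1) :
    -- the operator maps bounded pseudometrics to bounded pseudometrics
    (∀ π : BisimControl.Policy S A, ∀ d ∈ BisimControl.met S,
      M.bisimOp c d π ∈ BisimControl.met S) ∧
    -- for every fixed policy it has a least fixed point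
    (∀ π : BisimControl.Policy S A,
      ∃ d, IsLeast {d | d ∈ BisimControl.met S ∧ M.bisimOp c d π = d} d) ∧
    ∃ (πopt : BisimControl.Policy S A) (dopt : S → S → ℝ),
      -- policy improvement has exactly one fixed point, and it is an optimal policy
      (∀ π, G.improve π = π ↔ π = πopt) ∧ M.IsOptimal πopt ∧
      -- the operator, with the policy being improved, has a least fixed point,
      -- which is a bisimulation metric for the optimal policy
      IsLeast {d | ∃ π, G.improve π = π ∧ d ∈ BisimControl.met S ∧ M.bisimOp c d π = d} dopt ∧
      M.IsBisimMetric c πopt dopt ∧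
      -- from every initial policy, policy iteration improves and reaches the optimal value
      ∀ π₀ : BisimControl.Policy S A,
        (∀ k s, M.value (G.policyIter π₀ k) s ≤ M.value (G.policyIter π₀ (k + 1)) s) ∧
        TendstoUniformly (fun k => M.value (G.policyIter π₀ k)) (M.value πopt) atTop ∧
        -- for finite state and action spaces the policies reach the optimal policy
        (Finite S → Finite A → ∀ᶠ k in atTop, G.policyIter π₀ k = πopt) ∧
        -- and whenever they do, the metrics computed along the way converge
        ((∀ᶠ k in atTop, G.policyIter π₀ k = πopt) → ∀ d₀ ∈ BisimControl.met S,
          TendstoUniformly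
            (fun n (p : S × S) => M.metricIter c (G.policyIter π₀) d₀ n p.1 p.2)
            (fun p : S × S => dopt p.1 p.2) atTop) := by
  obtain ⟨V, hV, hfix⟩ := G.exists_bellman_fixed
  obtain ⟨d, hd, hdfix⟩ := M.exists_bisimOp_fixed hc0 hc1 (G.greedy V)
  have himp := G.improve_eq_self_iff hV hfix
  have hval := G.value_greedy_of_fixed hV hfix
  refine ⟨fun π d hd => M.bisimOp_mem_met hc0 hc1 π hd, fun π => ?_, G.greedy V, d, himp,
    fun π s => ?_, ⟨⟨G.greedy V, (himp _).2 rfl, hd, hdfix⟩, ?_⟩,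
    ⟨hd, fun x y => (congrFun₂ hdfix x y).symm⟩, fun π₀ => ⟨fun k s => ?_, ?_, fun _ _ => ?_,
    fun hev d₀ hd₀ => M.tendstoUniformly_metricIter hc0 hc1 hev hd₀ hd hdfix⟩⟩
  · obtain ⟨e, he, hefix⟩ := M.exists_bisimOp_fixed hc0 hc1 π
    exact ⟨e, ⟨he, hefix⟩, fun e' h' => (M.bisimOp_fixed_unique hc0 hc1 π he h'.1 hefix h'.2).le⟩
  · rw [hval]
    exact G.value_le_of_fixed hV hfix π s
  · rintro e ⟨π, hπ, he, hefix⟩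
    rw [(himp π).1 hπ] at hefix
    exact (M.bisimOp_fixed_unique hc0 hc1 _ hd he hdfix hefix).le
  · rw [G.policyIter_succ]
    exact G.value_le_value_improve _ s
  · rw [hval]
    exact G.tendstoUniformly_value_policyIter hV hfix π₀
  · exact G.eventually_policyIter_eq hV hfix π₀
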